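/- For each integer $n\ge 0$ let $0=X_0,X_1,\dots,X_n$ be an equilateral isotropic random walk of $n$ steps in the plane; that is, the steps $X_k-X_{k-1}$ ($1\le k\le n$) are independent and identically distributed, each has length $1$ almost surely, and the direction of each is uniformly distributed on the unit circle. Then the sum $X_n$ of the $n$ steps is $n$-quasi-Gaussian: there are constants $C$ and $N$ such that for every $n\ge N$ the distribution of $X_n$ has a density $f_n$ with respect to area (that is, with respect to $r\,dr\,d\vartheta$ in polar coordinates) whose value $f_n(r,\vartheta)$ at the point with polar coordinates $(r,\vartheta)$ satisfies $$\left|f_n(r,\vartheta)-\frac{1}{\pi n}\exp\left(-\frac{r^2}{n}\right)\right|\le \frac{C}{n^2}\qquad\text{for all } r\ge 0 \text{ and all real } \vartheta .$$ -/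

import Mathlib

open MeasureTheory ProbabilityTheory

noncomputable section

/-- The uniform probability distribution on the unit circle of the plane `ℂ`: the law of
`exp (i t)` for `t` uniform on `(-π, π]`. -/
def uniformCircle : Measure ℂ :=
  (ENNReal.ofReal (2 * Real.pi))⁻¹ •
    (volume.restrict (Set.Ioc (-Real.pi) Real.pi)).map
      (fun t : ℝ => Complex.exp ((t : ℂ) * Complex.I))

/-- The `k`-th step (increment) of a sequence `X 0, X 1, …, X n` of random points of the plane. -/
def walkStep {Ω : Type*} {n : ℕ} (X : Fin (n + 1) → Ω → ℂ) (k : Fin n) (ω : Ω) : ℂ :=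
  X k.succ ω - X k.castSucc ω

/-- `X 0, …, X n` is a random walk of `n` steps in the plane: it starts at the origin, and its
steps are independent and identically distributed. -/
structure IsRandomWalk {Ω : Type*} [MeasurableSpace Ω] (P : Measure Ω) {n : ℕ}
    (X : Fin (n + 1) → Ω → ℂ) : Prop where
  measurable : ∀ k, Measurable (X k)
  start : ∀ ω, X 0 ω = 0
  indep : iIndepFun (fun k : Fin n => walkStep X k) P
  ident : ∀ j k : Fin n, IdentDistrib (walkStep X j) (walkStep X k) P P

/-- The directions of the steps are uniformly distributed over the unit circle, independently of
the lengths of the steps. -/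
structure IsIsotropic {Ω : Type*} [MeasurableSpace Ω] (P : Measure Ω) {n : ℕ}
    (X : Fin (n + 1) → Ω → ℂ) : Prop where
  direction : ∀ k : Fin n,
    P.map (fun ω => walkStep X k ω / ((‖walkStep X k ω‖ : ℝ) : ℂ)) = uniformCircle
  indep_length : ∀ k : Fin n,
    IndepFun (fun ω => walkStep X k ω / ((‖walkStep X k ω‖ : ℝ) : ℂ))
      (fun ω => ‖walkStep X k ω‖) P

/-- Every step has unit length (almost surely). -/
def IsEquilateral {Ω : Type*} [MeasurableSpace Ω] (P : Measure Ω) {n : ℕ}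
    (X : Fin (n + 1) → Ω → ℂ) : Prop :=
  ∀ k : Fin n, ∀ᵐ ω ∂P, ‖walkStep X k ω‖ = 1

/-- `p` is a probability density of `μ` with respect to the area measure of the plane. -/
structure IsPlanarDensity (μ : Measure ℂ) (p : ℂ → ℝ) : Prop where
  measurable : Measurable p
  nonneg : ∀ z, 0 ≤ p z
  eq_withDensity : μ = (volume : Measure ℂ).withDensity (fun z => ENNReal.ofReal (p z))

/-- A family `μ n` of distributions in the plane is `n`-quasi-Gaussian: for all large `n` the
distribution `μ n` has a density with respect to area (`r dr dθ` in polar coordinates) whose value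
at the point with polar coordinates `(r, θ)` is `exp (-r² / n) / (π n) + O(1 / n²)`, with an
`O`-constant independent of `r`, `θ` and `n`. -/
def IsQuasiGaussian (μ : ℕ → Measure ℂ) : Prop :=
  ∃ C : ℝ, ∃ N : ℕ, ∀ n : ℕ, N ≤ n → ∃ p : ℂ → ℝ, IsPlanarDensity (μ n) p ∧
    ∀ r : ℝ, 0 ≤ r → ∀ θ : ℝ,
      |p ((r : ℂ) * Complex.exp ((θ : ℂ) * Complex.I)) -
        1 / (Real.pi * (n : ℝ)) * Real.exp (-(r ^ 2 / (n : ℝ)))| ≤ C / (n : ℝ) ^ 2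

end

/-! Each step has characteristic function `besselJZero ‖t‖`, so by independence that of `X_n` is its
`n`-th power. The target density is the inverse transform of `exp (-n‖t‖² / 4)`, and the sup
distance of two densities is at most a constant times the L¹ distance of their transforms. The
theorem thus reduces to an L¹ bound of order `1 / n²` in the plane,
`exists_integral_abs_besselJZero_pow_sub_exp_le`.

For small ρ, J₀(ρ) and `exp (-ρ² / 4)` agree up to O(ρ⁴), so their `n`-th powers differ by O(nρ⁴)
times a Gaussian of width `n^(-1/2)`. On that scale this is O(1/n), and the area of the disc gives
the second factor `1 / n`. Away from 0, |J₀| is bounded by some q < 1 (`exists_abs_besselJZero_le`),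
which makes the tails exponentially small.

The decay |J₀(ρ)| ≤ 3/√ρ makes the `n`-th power integrable over the plane for n ≥ 5; Lévy's
inversion (`eq_withDensity_levyDensity`) then provides the density. -/

noncomputable section

/-! ### Lévy inversion for integrable characteristic functions -/

section LevyInversion

open Complex Filter Topology
open scoped FourierTransform RealInnerProductSpace

variable {V : Type*} [NormedAddCommGroup V] [InnerProductSpace ℝ V]

/-- The Gaussian probability density of parameter `c` centred at the origin, which concentrates
at the origin as `c → ∞`. -/
def gaussKernel (V : Type*) [NormedAddCommGroup V] [InnerProductSpace ℝ V] (c : ℝ) (v : V) : ℝ :=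
  (Real.pi * c) ^ (Module.finrank ℝ V / 2 : ℝ) * Real.exp (-(Real.pi ^ 2 * c) * ‖v‖ ^ 2)

lemma gaussKernel_nonneg {c : ℝ} (hc : 0 < c) (v : V) : 0 ≤ gaussKernel V c v := by
  unfold gaussKernel; positivity

lemma continuous_gaussKernel (c : ℝ) : Continuous (gaussKernel V c) := by
  unfold gaussKernel; fun_prop

lemma gaussKernel_le {c : ℝ} (hc : 0 < c) (v : V) :
    gaussKernel V c v ≤ (Real.pi * c) ^ (Module.finrank ℝ V / 2 : ℝ) := by
  unfold gaussKernel
  refine mul_le_of_le_one_right (by positivity) (Real.exp_le_one_iff.2 ?_)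
  have : 0 ≤ Real.pi ^ 2 * c * ‖v‖ ^ 2 := by positivity
  linarith

variable [MeasurableSpace V] [BorelSpace V]

lemma continuous_charFun_of_isProbabilityMeasure (μ : Measure V) [IsProbabilityMeasure μ] :
     Continuous (charFun μ) := by
  have : charFun μ = fun t => VectorFourier.fourierIntegral Real.fourierChar μ (innerₗ V) 1
      (-(2 * Real.pi)⁻¹ • t) := funext fun t => charFun_eq_fourierIntegral' t
  rw [this]
  exact (VectorFourier.fourierIntegral_continuous Real.continuous_fourierChar continuous_inner
    (integrable_const (1 : ℂ))).comp (continuous_const_smul _)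

variable [FiniteDimensional ℝ V]

lemma integrable_exp_neg_mul_sq_norm {b : ℝ} (hb : 0 < b) :
    Integrable (fun v : V => Real.exp (-b * ‖v‖ ^ 2)) := by
  have h := (GaussianFourier.integrable_cexp_neg_mul_sq_norm_add (V := V) (b := (b : ℂ))
    (by simpa using hb) 0 0).re
  refine h.congr (Eventually.of_forall fun v => ?_)
  have : (-(b : ℂ) * ‖v‖ ^ 2 + 0 * ((⟪(0 : V), v⟫ : ℝ) : ℂ)) = ((-b * ‖v‖ ^ 2 : ℝ) : ℂ) := by
    push_cast; ring
  simp only [this, RCLike.re_eq_complex_re, Complex.exp_ofReal_re]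

lemma integrable_gaussKernel {c : ℝ} (hc : 0 < c) : Integrable (gaussKernel V c) :=
  (integrable_exp_neg_mul_sq_norm (by positivity)).const_mul _

lemma integral_gaussKernel {c : ℝ} (hc : 0 < c) : ∫ v : V, gaussKernel V c v = 1 := by
  unfold gaussKernel
  rw [integral_const_mul, GaussianFourier.integral_rexp_neg_mul_sq_norm (by positivity),
    ← Real.mul_rpow (by positivity) (by positivity)]
  have : Real.pi * c * (Real.pi / (Real.pi ^ 2 * c)) = 1 := by
    field_simp
  rw [this, Real.one_rpow]

lemma lintegral_gaussKernel {c : ℝ} (hc : 0 < c) :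
    ∫⁻ v : V, ENNReal.ofReal (gaussKernel V c v) = 1 := by
  rw [← ofReal_integral_eq_lintegral_ofReal (integrable_gaussKernel hc)
    (Eventually.of_forall fun v => gaussKernel_nonneg hc v), integral_gaussKernel hc,
    ENNReal.ofReal_one]

variable (μ : Measure V) [IsProbabilityMeasure μ]

omit [FiniteDimensional ℝ V] in
lemma integrable_gaussKernel_sub {c : ℝ} (hc : 0 < c) (z : V) :
    Integrable (fun x => gaussKernel V c (z - x)) μ := by
  refine Integrable.of_bound ((continuous_gaussKernel c).comp
    (continuous_const.sub continuous_id)).aestronglyMeasurable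
    ((Real.pi * c) ^ (Module.finrank ℝ V / 2 : ℝ)) (Eventually.of_forall fun x => ?_)
  rw [Real.norm_of_nonneg (gaussKernel_nonneg hc _)]
  exact gaussKernel_le hc _

/-- The inverse Fourier transform of a characteristic function, regularised by a Gaussian factor,
is the convolution of the measure with a Gaussian kernel. -/
lemma integral_cexp_smul_charFun {c : ℝ} (hc : 0 < c) (z : V) :
    ∫ w : V, cexp (-(c : ℂ)⁻¹ * ‖w‖ ^ 2) •
        (Real.fourierChar (-⟪w, z⟫) • charFun μ ((2 * Real.pi) • w)) =
      ((∫ x, gaussKernel V c (z - x) ∂μ : ℝ) : ℂ) := by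
  have hre : 0 < ((c : ℂ)⁻¹).re := by
    rw [← Complex.ofReal_inv, Complex.ofReal_re]; positivity
  have J : Integrable
      (fun w : V => cexp (-(c : ℂ)⁻¹ * ‖w‖ ^ 2 + 2 * Real.pi * I * (⟪z, w⟫ : ℝ))) :=
    GaussianFourier.integrable_cexp_neg_mul_sq_norm_add hre _ _
  -- Fubini in the form ∫ f̂ dμ = ∫ f μ̂, with f a modulated Gaussian whose transform is the kernel
  -- centred at `z`.
  have key := VectorFourier.integral_fourierIntegral_smul_eq_flip (L := innerₗ V) (μ := volume)
    (ν := μ) Real.continuous_fourierChar continuous_inner J (integrable_const (1 : ℂ))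
  have lhs : ∀ x : V, VectorFourier.fourierIntegral Real.fourierChar volume (innerₗ V)
      (fun w : V => cexp (-(c : ℂ)⁻¹ * ‖w‖ ^ 2 + 2 * Real.pi * I * (⟪z, w⟫ : ℝ))) x =
      ((gaussKernel V c (z - x) : ℝ) : ℂ) := by
    intro x
    refine (fourier_gaussian_innerProductSpace' hre z x).trans ?_
    unfold gaussKernel
    rw [Complex.ofReal_mul, Complex.ofReal_cpow (by positivity)]
    push_cast
    rw [div_inv_eq_mul]
    congr 2
    rw [div_inv_eq_mul]; ring
  have rhs : ∀ w : V, VectorFourier.fourierIntegral Real.fourierChar μ (innerₗ V).flip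
      (fun _ => (1 : ℂ)) w = charFun μ ((2 * Real.pi) • (-w)) := by
    intro w
    rw [charFun_eq_fourierIntegral', flip_innerₗ]
    congr 1
    rw [smul_smul, neg_mul, inv_mul_cancel₀ (by positivity)]
    simp
  simp only [lhs, rhs, smul_eq_mul, mul_one] at key
  rw [integral_complex_ofReal] at key
  rw [key, ← integral_neg_eq_self]
  refine integral_congr_ae (Eventually.of_forall fun w => ?_)
  simp only [norm_neg, neg_neg, smul_eq_mul, inner_neg_left]
  rw [Complex.exp_add, Circle.smul_def, Real.fourierChar_apply, smul_eq_mul,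
    ← mul_assoc, real_inner_comm]
  congr 3
  push_cast
  ring

/-- The candidate for the density of `μ`: the inverse Fourier transform of its characteristic
function. -/
def levyDensity (μ : Measure V) (z : V) : ℂ :=
  𝓕 (fun w : V => charFun μ ((2 * Real.pi) • w)) z

variable {μ}

omit [IsProbabilityMeasure μ] in
lemma integrable_charFun_two_pi_smul (h : Integrable (charFun μ)) :
    Integrable (fun w : V => charFun μ ((2 * Real.pi) • w)) :=
  h.comp_smul (by positivity)

omit [IsProbabilityMeasure μ] in
lemma continuous_levyDensity (h : Integrable (charFun μ)) : Continuous (levyDensity μ) :=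
  VectorFourier.fourierIntegral_continuous Real.continuous_fourierChar continuous_inner
    (integrable_charFun_two_pi_smul h)

/-- The regularising factor tends to 1 as `c → ∞`, and integrability of the characteristic function
lets the limit pass inside the integral. -/
lemma tendsto_gaussKernel_convolution (h : Integrable (charFun μ)) (z : V) :
    Tendsto (fun c : ℝ => ((∫ x, gaussKernel V c (z - x) ∂μ : ℝ) : ℂ)) atTop
      (𝓝 (levyDensity μ z)) := by
  have hint : Integrable
      (fun w : V => Real.fourierChar (-⟪w, z⟫) • charFun μ ((2 * Real.pi) • w)) :=
    (VectorFourier.fourierIntegral_convergent_iff Real.continuous_fourierChar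
      (L := innerₗ V) continuous_inner z).2 (integrable_charFun_two_pi_smul h)
  have := Real.tendsto_integral_cexp_sq_smul hint
  rw [levyDensity, Real.fourier_eq]
  refine this.congr' ?_
  filter_upwards [Ioi_mem_atTop (0 : ℝ)] with c (hc : 0 < c)
  rw [← integral_cexp_smul_charFun μ hc z]
  norm_cast

/-- Convolutions of `μ` with a positive kernel are nonnegative reals, and these form a closed subset
of ℂ. -/
lemma levyDensity_mem (h : Integrable (charFun μ)) (z : V) :
    levyDensity μ z ∈ {w : ℂ | w.im = 0 ∧ 0 ≤ w.re} := by
  have hclosed : IsClosed {w : ℂ | w.im = 0 ∧ 0 ≤ w.re} :=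
    (isClosed_eq Complex.continuous_im continuous_const).inter
      (isClosed_le continuous_const Complex.continuous_re)
  refine hclosed.mem_of_tendsto (tendsto_gaussKernel_convolution h z) ?_
  filter_upwards [Ioi_mem_atTop (0 : ℝ)] with c (hc : 0 < c)
  exact ⟨Complex.ofReal_im _, by
    rw [Complex.ofReal_re]; exact integral_nonneg fun x => gaussKernel_nonneg hc _⟩

lemma levyDensity_re_nonneg (h : Integrable (charFun μ)) (z : V) : 0 ≤ (levyDensity μ z).re :=
  (levyDensity_mem h z).2

lemma ofReal_levyDensity_re (h : Integrable (charFun μ)) (z : V) :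
    (((levyDensity μ z).re : ℝ) : ℂ) = levyDensity μ z :=
  Complex.ext (by simp) (by simp [(levyDensity_mem h z).1])

lemma lintegral_gaussKernel_convolution {c : ℝ} (hc : 0 < c) :
    ∫⁻ z : V, ENNReal.ofReal (∫ x, gaussKernel V c (z - x) ∂μ) = 1 := by
  have h1 : ∀ z : V, ENNReal.ofReal (∫ x, gaussKernel V c (z - x) ∂μ) =
      ∫⁻ x, ENNReal.ofReal (gaussKernel V c (z - x)) ∂μ := fun z =>
    ofReal_integral_eq_lintegral_ofReal (integrable_gaussKernel_sub μ hc z)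
      (Eventually.of_forall fun x => gaussKernel_nonneg hc _)
  simp only [h1]
  rw [lintegral_lintegral_swap]
  · have h2 : ∀ x : V, ∫⁻ z : V, ENNReal.ofReal (gaussKernel V c (z - x)) = 1 := fun x => by
      rw [lintegral_sub_right_eq_self (fun z => ENNReal.ofReal (gaussKernel V c z)) x,
        lintegral_gaussKernel hc]
    simp [h2]
  · have : Continuous fun p : V × V => gaussKernel V c (p.1 - p.2) :=
      (continuous_gaussKernel c).comp (continuous_fst.sub continuous_snd)
    exact this.measurable.ennreal_ofReal.aemeasurable

/-- Fatou's lemma along `c = n + 1`. The inequality suffices: it gives the integrability that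
Fourier inversion requires. -/
lemma lintegral_levyDensity_le_one (h : Integrable (charFun μ)) :
    ∫⁻ z : V, ENNReal.ofReal (levyDensity μ z).re ≤ 1 := by
  have ht : ∀ z : V, Tendsto (fun n : ℕ => ENNReal.ofReal
      (∫ x, gaussKernel V ((n : ℝ) + 1) (z - x) ∂μ)) atTop
      (𝓝 (ENNReal.ofReal (levyDensity μ z).re)) := fun z => by
    have h1 := (Complex.continuous_re.tendsto _).comp ((tendsto_gaussKernel_convolution h z).comp
      (tendsto_atTop_add_const_right atTop (1 : ℝ) tendsto_natCast_atTop_atTop))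
    exact (ENNReal.continuous_ofReal.tendsto _).comp h1
  calc ∫⁻ z : V, ENNReal.ofReal (levyDensity μ z).re
      = ∫⁻ z : V, liminf (fun n : ℕ => ENNReal.ofReal
          (∫ x, gaussKernel V ((n : ℝ) + 1) (z - x) ∂μ)) atTop :=
        lintegral_congr fun z => (ht z).liminf_eq.symm
    _ ≤ liminf (fun n : ℕ => ∫⁻ z : V, ENNReal.ofReal
          (∫ x, gaussKernel V ((n : ℝ) + 1) (z - x) ∂μ)) atTop := by
        refine lintegral_liminf_le fun n => ?_
        have : Continuous fun p : V × V => gaussKernel V ((n : ℝ) + 1) (p.1 - p.2) :=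
          (continuous_gaussKernel _).comp (continuous_fst.sub continuous_snd)
        exact (this.stronglyMeasurable.integral_prod_right (ν := μ)).measurable.ennreal_ofReal
    _ ≤ 1 := by
        have : ∀ n : ℕ, ∫⁻ z : V, ENNReal.ofReal
          (∫ x, gaussKernel V ((n : ℝ) + 1) (z - x) ∂μ) = 1 := fun n =>
          lintegral_gaussKernel_convolution (by positivity)
        simp [this]

lemma integrable_levyDensity (h : Integrable (charFun μ)) : Integrable (levyDensity μ) := by
  have hre : Integrable (fun z : V => (levyDensity μ z).re) := by
    refine ⟨(Complex.continuous_re.comp (continuous_levyDensity h)).aestronglyMeasurable, ?_⟩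
    rw [hasFiniteIntegral_iff_ofReal (Eventually.of_forall (levyDensity_re_nonneg h))]
    exact (lintegral_levyDensity_le_one h).trans_lt ENNReal.one_lt_top
  exact hre.ofReal.congr (Eventually.of_forall (ofReal_levyDensity_re h))

/-- **Lévy's inversion formula**: a probability measure with integrable characteristic function is
absolutely continuous, and the inverse Fourier transform of the characteristic function is a
density. -/
theorem eq_withDensity_levyDensity (h : Integrable (charFun μ)) :
    μ = volume.withDensity (fun z => ENNReal.ofReal (levyDensity μ z).re) := by
  have hmeas : Measurable (fun z => ENNReal.ofReal (levyDensity μ z).re) :=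
    (Complex.continuous_re.comp (continuous_levyDensity h)).measurable.ennreal_ofReal
  have : IsFiniteMeasure (volume.withDensity (fun z => ENNReal.ofReal (levyDensity μ z).re)) :=
    isFiniteMeasure_withDensity
      ((lintegral_levyDensity_le_one h).trans_lt ENNReal.one_lt_top).ne
  refine Measure.ext_of_charFun (funext fun t => ?_)
  -- Inversion recovers the characteristic function from the candidate density; evaluating at `t /
  -- (2π)` undoes the rescaling in `levyDensity`.
  have hinv := congrFun (Continuous.fourierInv_fourier_eq
    ((continuous_charFun_of_isProbabilityMeasure μ).comp (continuous_const_smul (2 * Real.pi)))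
    (integrable_charFun_two_pi_smul h) (integrable_levyDensity h)) ((2 * Real.pi)⁻¹ • t)
  rw [Function.comp_apply, smul_smul, mul_inv_cancel₀ (by positivity), one_smul] at hinv
  rw [← hinv, Real.fourierInv_eq, charFun_apply, integral_withDensity_eq_integral_toReal_smul hmeas
    (Eventually.of_forall fun z => ENNReal.ofReal_lt_top)]
  refine integral_congr_ae (Eventually.of_forall fun z => ?_)
  simp only
  rw [ENNReal.toReal_ofReal (levyDensity_re_nonneg h z), Complex.real_smul,
    ofReal_levyDensity_re h, Circle.smul_def, smul_eq_mul, mul_comm, Real.fourierChar_apply,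
    inner_smul_right]
  congr 3
  push_cast
  field_simp

end LevyInversion

/-! ### Bounds for the Bessel function J₀ -/

section Bessel

open Real intervalIntegral

/-- The Bessel function `J₀`, in Bessel's integral representation. -/
def besselJZero (ρ : ℝ) : ℝ := (2 * π)⁻¹ * ∫ s in -π..π, cos (ρ * cos s)

lemma intervalIntegrable_cos_mul_cos (ρ a b : ℝ) :
    IntervalIntegrable (fun s => cos (ρ * cos s)) volume a b :=
  (by fun_prop : Continuous fun s => cos (ρ * cos s)).intervalIntegrable a b

lemma continuous_besselJZero : Continuous besselJZero := by
  unfold besselJZero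
  refine continuous_const.mul
    (continuous_parametric_intervalIntegral_of_continuous' (by fun_prop) _ _)

lemma two_pi_mul_besselJZero (ρ : ℝ) :
    2 * π * besselJZero ρ = ∫ s in -π..π, cos (ρ * cos s) := by
  unfold besselJZero
  rw [← mul_assoc, mul_inv_cancel₀ (by positivity), one_mul]

lemma besselJZero_lt_one {ρ : ℝ} (hρ : 0 < ρ) : besselJZero ρ < 1 := by
  have hpos : 0 < ∫ s in -π..π, (1 - cos (ρ * cos s)) := by
    refine integral_pos (by linarith [pi_pos]) (by fun_prop)
      (fun s _ => sub_nonneg.2 (cos_le_one _)) ?_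
    -- At this point `0 < ρ cos s ≤ 1 < π`, so the integrand is strictly positive.
    refine ⟨arccos (min 1 ρ⁻¹), ⟨by linarith [arccos_nonneg (min 1 ρ⁻¹), pi_pos],
      arccos_le_pi _⟩, ?_⟩
    have h0 : 0 < min 1 ρ⁻¹ := lt_min one_pos (inv_pos.2 hρ)
    rw [cos_arccos (by linarith) (min_le_left _ _), sub_pos]
    conv_rhs => rw [← cos_zero]
    refine cos_lt_cos_of_nonneg_of_le_pi le_rfl ?_ (mul_pos hρ h0)
    calc ρ * min 1 ρ⁻¹ ≤ ρ * ρ⁻¹ := by gcongr; exact min_le_right _ _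
      _ = 1 := mul_inv_cancel₀ hρ.ne'
      _ ≤ π := by linarith [pi_gt_three]
  rw [integral_sub (by simp) (intervalIntegrable_cos_mul_cos _ _ _),
    ← two_pi_mul_besselJZero] at hpos
  simp only [intervalIntegral.integral_const, smul_eq_mul, mul_one] at hpos
  nlinarith [pi_pos]

lemma neg_one_lt_besselJZero (ρ : ℝ) : -1 < besselJZero ρ := by
  have hpos : 0 < ∫ s in -π..π, (1 + cos (ρ * cos s)) := by
    refine integral_pos (by linarith [pi_pos]) (by fun_prop)
      (fun s _ => by linarith [neg_one_le_cos (ρ * cos s)]) ?_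
    exact ⟨π / 2, ⟨by linarith [pi_pos], by linarith [pi_pos]⟩, by simp⟩
  rw [integral_add (by simp) (intervalIntegrable_cos_mul_cos _ _ _),
    ← two_pi_mul_besselJZero] at hpos
  simp only [intervalIntegral.integral_const, smul_eq_mul, mul_one] at hpos
  nlinarith [pi_pos]

lemma besselJZero_zero : besselJZero 0 = 1 := by
  have h := two_pi_mul_besselJZero 0
  simp only [zero_mul, cos_zero, intervalIntegral.integral_const, smul_eq_mul, mul_one] at h
  nlinarith [pi_pos]

lemma abs_besselJZero_lt_one {ρ : ℝ} (hρ : 0 < ρ) : |besselJZero ρ| < 1 :=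
  abs_lt.2 ⟨neg_one_lt_besselJZero ρ, besselJZero_lt_one hρ⟩

lemma abs_besselJZero_le_one {ρ : ℝ} (hρ : 0 ≤ ρ) : |besselJZero ρ| ≤ 1 := by
  rcases hρ.eq_or_lt with rfl | h
  · simp [besselJZero_zero]
  · exact (abs_besselJZero_lt_one h).le

/-- Average the second-order Taylor bound `cos_bound`, the source of 5/96, over the circle, where
cos² has mean 1/2. -/
lemma abs_besselJZero_sub_le {ρ : ℝ} (h0 : 0 ≤ ρ) (h1 : ρ ≤ 1) :
    |besselJZero ρ - (1 - ρ ^ 2 / 4)| ≤ 5 / 96 * ρ ^ 4 := by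
  have hmain : ∫ s in -π..π, (1 - (ρ * cos s) ^ 2 / 2) = 2 * π * (1 - ρ ^ 2 / 4) := by
    have : ∀ s, 1 - (ρ * cos s) ^ 2 / 2 = 1 - ρ ^ 2 / 2 * cos s ^ 2 := fun s => by ring
    simp only [this]
    rw [integral_sub (by simp) (Continuous.intervalIntegrable (by fun_prop) _ _),
      intervalIntegral.integral_const_mul, integral_cos_sq]
    simp
    ring
  have hle : |∫ s in -π..π, (cos (ρ * cos s) - (1 - (ρ * cos s) ^ 2 / 2))| ≤
      5 / 96 * ρ ^ 4 * |π - -π| := by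
    rw [← norm_eq_abs]
    refine norm_integral_le_of_norm_le_const fun s _ => ?_
    have hx : |ρ * cos s| ≤ ρ := by
      rw [abs_mul, abs_of_nonneg h0]
      exact mul_le_of_le_one_right h0 (abs_cos_le_one s)
    rw [norm_eq_abs]
    refine (cos_bound (hx.trans h1)).trans ?_
    rw [mul_comm]
    gcongr
  rw [integral_sub (intervalIntegrable_cos_mul_cos _ _ _)
    (Continuous.intervalIntegrable (by fun_prop) _ _), hmain, ← two_pi_mul_besselJZero,
    ← mul_sub, abs_mul, abs_of_pos (by positivity : 0 < 2 * π), sub_neg_eq_add,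
    abs_of_pos (by positivity : 0 < π + π)] at hle
  nlinarith [pi_pos]

lemma besselJZero_eq_quarter (ρ : ℝ) :
    π / 2 * besselJZero ρ = ∫ s in (0 : ℝ)..π / 2, cos (ρ * cos s) := by
  have hi := intervalIntegrable_cos_mul_cos ρ
  have h1 : ∫ s in -π..0, cos (ρ * cos s) = ∫ s in (0 : ℝ)..π, cos (ρ * cos s) := by
    have := integral_comp_neg (a := (0 : ℝ)) (b := π) (fun s => cos (ρ * cos s))
    simpa using this.symm
  have h2 : ∫ s in π / 2..π, cos (ρ * cos s) = ∫ s in (0 : ℝ)..π / 2, cos (ρ * cos s) := by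
    have := integral_comp_sub_left (a := (0 : ℝ)) (b := π / 2) (fun s => cos (ρ * cos s)) π
    simp only [cos_pi_sub, mul_neg, cos_neg, sub_zero] at this
    rw [this]
    congr 1
    ring
  have h := two_pi_mul_besselJZero ρ
  rw [← integral_add_adjacent_intervals (hi (-π) 0) (hi 0 π), h1,
    ← integral_add_adjacent_intervals (hi 0 (π / 2)) (hi (π / 2) π), h2] at h
  linarith

/-- Van der Corput's estimate away from the stationary point of the phase. -/
lemma abs_integral_cos_mul_cos_le {ρ ε : ℝ} (hρ : 0 < ρ) (hε : 0 < ε) (hε' : ε ≤ π / 2) :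
    |∫ t in ε..π / 2, cos (ρ * cos t)| ≤ 2 / (ρ * sin ε) := by
  have hsin : ∀ t ∈ Set.uIcc ε (π / 2), 0 < sin t := fun t ht => by
    rw [Set.uIcc_of_le hε'] at ht
    exact sin_pos_of_pos_of_lt_pi (by linarith [ht.1]) (by linarith [ht.2, pi_pos])
  have hcos : ∀ t ∈ Set.uIcc ε (π / 2), 0 ≤ cos t := fun t ht => by
    rw [Set.uIcc_of_le hε'] at ht
    exact cos_nonneg_of_neg_pi_div_two_le_of_le (by linarith [ht.1]) ht.2
  -- Integration by parts against the derivative of the phase; the remainder is dominated by the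
  -- nonnegative derivative of `-(ρ sin t)⁻¹`, which integrates exactly.
  have hF : ∀ t ∈ Set.uIcc ε (π / 2), HasDerivAt (fun t => -sin (ρ * cos t) / (ρ * sin t))
      (cos (ρ * cos t) + sin (ρ * cos t) * (cos t / (ρ * sin t ^ 2))) t := fun t ht => by
    have hs := (hsin t ht).ne'
    have h1 := (((hasDerivAt_cos t).const_mul ρ).sin.neg).div ((hasDerivAt_sin t).const_mul ρ)
      (by positivity)
    convert! h1 using 1
    simp only [Pi.neg_apply]
    field_simp
    ring
  have hG : ∀ t ∈ Set.uIcc ε (π / 2), HasDerivAt (fun t => -(ρ * sin t)⁻¹)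
      (cos t / (ρ * sin t ^ 2)) t := fun t ht => by
    have hs := (hsin t ht).ne'
    have h1 := (((hasDerivAt_sin t).const_mul ρ).inv (by positivity)).neg
    convert! h1 using 1
    field_simp
  have hcont : ContinuousOn (fun t => cos t / (ρ * sin t ^ 2)) (Set.uIcc ε (π / 2)) := by
    refine continuous_cos.continuousOn.div (by fun_prop) fun t ht => ?_
    have := hsin t ht
    positivity
  have hGi := hcont.intervalIntegrable (μ := volume)
  have hSi : IntervalIntegrable (fun t => sin (ρ * cos t) * (cos t / (ρ * sin t ^ 2))) volume
      ε (π / 2) := by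
    refine ContinuousOn.intervalIntegrable (ContinuousOn.mul (by fun_prop) hcont)
  have hCi := intervalIntegrable_cos_mul_cos ρ ε (π / 2)
  have e1 := integral_eq_sub_of_hasDerivAt hF (hCi.add hSi)
  have e2 := integral_eq_sub_of_hasDerivAt hG hGi
  rw [integral_add hCi hSi] at e1
  have hle : |∫ t in ε..π / 2, sin (ρ * cos t) * (cos t / (ρ * sin t ^ 2))| ≤
      ∫ t in ε..π / 2, cos t / (ρ * sin t ^ 2) := by
    rw [← norm_eq_abs]
    refine norm_integral_le_of_norm_le hε' (Filter.Eventually.of_forall fun t ht => ?_) hGi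
    have ht' : t ∈ Set.uIcc ε (π / 2) := Set.uIcc_of_le hε' ▸ Set.Ioc_subset_Icc_self ht
    have hp : 0 ≤ cos t / (ρ * sin t ^ 2) := div_nonneg (hcos t ht') (by positivity)
    rw [norm_mul, norm_of_nonneg hp]
    exact mul_le_of_le_one_left hp (abs_sin_le_one _)
  have hs := hsin ε Set.left_mem_uIcc
  have hb : |sin (ρ * cos ε) / (ρ * sin ε)| ≤ (ρ * sin ε)⁻¹ := by
    rw [abs_div, abs_of_pos (by positivity : 0 < ρ * sin ε), div_eq_mul_inv]
    exact mul_le_of_le_one_left (by positivity) (abs_sin_le_one _)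
  have hr : (0 : ℝ) < ρ⁻¹ := by positivity
  simp only [cos_pi_div_two, mul_zero, sin_zero, neg_zero, zero_div, sin_pi_div_two, mul_one,
    neg_div] at e1 e2
  rw [e2] at hle
  rw [div_eq_mul_inv 2 (ρ * sin ε)]
  rw [abs_le] at hle hb ⊢
  constructor <;> linarith [hle.1, hle.2, hb.1, hb.2]

/-- For ρ ≥ 1, cut the quarter period at `ε = ρ^(-1/2)`: the trivial bound gives ε near the
stationary point, and van der Corput with `sin ε ≥ 2ε/π` gives πε on the rest. -/
lemma abs_besselJZero_le_div_sqrt {ρ : ℝ} (hρ : 0 < ρ) : |besselJZero ρ| ≤ 3 / √ρ := by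
  have hs : 0 < √ρ := sqrt_pos.2 hρ
  rcases le_total ρ 1 with h | h
  · refine (abs_besselJZero_le_one hρ.le).trans ?_
    rw [le_div_iff₀ hs]
    linarith [sqrt_le_one.2 h]
  set ε : ℝ := (√ρ)⁻¹ with hε
  have hε0 : 0 < ε := by positivity
  have hε1 : ε ≤ 1 := inv_le_one_of_one_le₀ (one_le_sqrt.2 h)
  have hεπ : ε ≤ π / 2 := by linarith [pi_gt_three]
  have h1 := abs_integral_cos_mul_cos_le hρ hε0 hεπ
  have h2 : |∫ t in (0 : ℝ)..ε, cos (ρ * cos t)| ≤ 1 * |ε - 0| := by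
    rw [← norm_eq_abs]
    exact norm_integral_le_of_norm_le_const fun s _ => abs_cos_le_one _
  have h3 : 2 / (ρ * sin ε) ≤ π * ε := by
    have hsin := mul_le_sin hε0.le hεπ
    have hρε : ρ * ε * ε = 1 := by
      rw [hε]; field_simp; exact (sq_sqrt hρ.le).symm
    have hpos : 0 < sin ε := lt_of_lt_of_le (by positivity) hsin
    rw [div_le_iff₀ (by positivity)]
    calc (2 : ℝ) = π * (ρ * ε) * (2 / π * ε) := by
          field_simp; linarith
      _ ≤ π * (ρ * ε) * sin ε := by gcongr
      _ = π * ε * (ρ * sin ε) := by ring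
  have hsplit := integral_add_adjacent_intervals (intervalIntegrable_cos_mul_cos ρ 0 ε)
    (intervalIntegrable_cos_mul_cos ρ ε (π / 2))
  rw [← besselJZero_eq_quarter] at hsplit
  have h4 : π / 2 * |besselJZero ρ| ≤ ε + π * ε := by
    rw [← abs_of_pos (by positivity : 0 < π / 2), ← abs_mul, ← hsplit]
    refine (abs_add_le _ _).trans (add_le_add ?_ (h1.trans ?_))
    · simpa [abs_of_pos hε0] using h2
    · simpa [abs_of_pos pi_pos] using h3
  rw [div_eq_mul_inv, ← hε]
  nlinarith [pi_gt_three]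

/-- Compactness on `[1, 36]`; beyond 36 the decay bound `3/√ρ` is at most 1/2. -/
lemma exists_abs_besselJZero_le : ∃ q : ℝ, 0 < q ∧ q < 1 ∧ ∀ ρ, 1 ≤ ρ → |besselJZero ρ| ≤ q := by
  obtain ⟨x, hx, hmax⟩ := (isCompact_Icc (a := (1 : ℝ)) (b := 36)).exists_isMaxOn
    ⟨1, by norm_num⟩ continuous_besselJZero.abs.continuousOn
  refine ⟨max (1 / 2) |besselJZero x|, by positivity,
    max_lt (by norm_num) (abs_besselJZero_lt_one (by linarith [hx.1])), fun ρ hρ => ?_⟩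
  rcases le_total ρ 36 with h | h
  · exact le_max_of_le_right (hmax ⟨hρ, h⟩)
  · refine le_max_of_le_left ((abs_besselJZero_le_div_sqrt (by linarith)).trans ?_)
    have : 6 ≤ √ρ := le_sqrt_of_sq_le (by linarith)
    rw [div_le_div_iff₀ (by linarith) (by norm_num)]
    linarith

end Bessel

/-! ### L¹ comparison of the characteristic functions -/

section CharFunEstimates

open Real Filter

/-- Both bases are at most `exp (-ρ²/8)` and differ by at most ρ⁴, so the powers differ by at most
`nρ⁴ exp (-(n-1)ρ²/8)`. Half of the exponent absorbs (nρ²)², leaving a factor `1 / n`. -/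
lemma abs_besselJZero_pow_sub_exp_le {ρ : ℝ} (h0 : 0 ≤ ρ) (h1 : ρ ≤ 1) {n : ℕ} (hn : 2 ≤ n) :
    |besselJZero ρ ^ n - exp (-(ρ ^ 2 / 4)) ^ n| ≤ 2048 / n * exp (-(n / 32) * ρ ^ 2) := by
  have hJ := abs_le.1 (abs_besselJZero_sub_le h0 h1)
  have hsq : ρ ^ 2 ≤ 1 := pow_le_one₀ h0 h1
  have hsq0 : 0 ≤ ρ ^ 2 := sq_nonneg ρ
  have h4 : ρ ^ 4 = ρ ^ 2 * ρ ^ 2 := by ring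
  have h4le : ρ ^ 4 ≤ ρ ^ 2 := by rw [h4]; exact mul_le_of_le_one_left hsq0 hsq
  have hexp : |exp (-(ρ ^ 2 / 4)) - 1 - -(ρ ^ 2 / 4)| ≤ (-(ρ ^ 2 / 4)) ^ 2 :=
    abs_exp_sub_one_sub_id_le (by rw [abs_neg, abs_of_nonneg (by positivity)]; linarith)
  have hexp' : (-(ρ ^ 2 / 4)) ^ 2 = ρ ^ 4 / 16 := by ring
  rw [hexp'] at hexp
  have hE := abs_le.1 hexp
  have hM : 1 - ρ ^ 2 / 8 ≤ exp (-(ρ ^ 2 / 8)) := by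
    linarith [add_one_le_exp (-(ρ ^ 2 / 8))]
  have hdiff : |besselJZero ρ - exp (-(ρ ^ 2 / 4))| ≤ ρ ^ 4 := by
    rw [abs_le]; constructor <;> linarith [hJ.1, hJ.2, hE.1, hE.2, sq_nonneg (ρ ^ 2)]
  have ha : |besselJZero ρ| ≤ exp (-(ρ ^ 2 / 8)) := by
    rw [abs_le]; constructor <;> linarith [hJ.1, hJ.2]
  have hb : |exp (-(ρ ^ 2 / 4))| ≤ exp (-(ρ ^ 2 / 8)) := by
    rw [abs_exp, exp_le_exp]; linarith
  have hn0 : (0 : ℝ) < n := by positivity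
  have hn2 : (2 : ℝ) ≤ n := by exact_mod_cast hn
  have hpow : exp (-(ρ ^ 2 / 8)) ^ (n - 1) ≤ exp (-(2 * (n / 32 * ρ ^ 2))) := by
    rw [← exp_nat_mul, exp_le_exp, Nat.cast_sub (by omega)]
    push_cast
    nlinarith
  set y : ℝ := n / 32 * ρ ^ 2 with hy
  have hy0 : 0 ≤ y := by positivity
  have hquad : y ^ 2 ≤ 2 * exp y := by linarith [quadratic_le_exp_of_nonneg hy0]
  calc |besselJZero ρ ^ n - exp (-(ρ ^ 2 / 4)) ^ n|
      ≤ |besselJZero ρ - exp (-(ρ ^ 2 / 4))| * n *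
          max |besselJZero ρ| |exp (-(ρ ^ 2 / 4))| ^ (n - 1) := abs_pow_sub_pow_le _ _ _
    _ ≤ ρ ^ 4 * n * exp (-(ρ ^ 2 / 8)) ^ (n - 1) := by
        gcongr
        exact max_le ha hb
    _ ≤ ρ ^ 4 * n * exp (-(2 * y)) := by gcongr
    _ = 1024 / n * (y ^ 2 * exp (-(2 * y))) := by rw [hy]; field_simp; ring
    _ ≤ 1024 / n * (2 * exp y * exp (-(2 * y))) := by gcongr
    _ = 2048 / n * exp (-(n / 32) * ρ ^ 2) := by
        rw [mul_assoc 2, ← exp_add, show y + -(2 * y) = -(n / 32) * ρ ^ 2 by rw [hy]; ring]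
        ring

lemma abs_besselJZero_le_rpow {ρ : ℝ} (h0 : 0 ≤ ρ) :
    |besselJZero ρ| ≤ 6 * (1 + ρ) ^ (-(1 / 2) : ℝ) := by
  rw [rpow_neg (by positivity), ← sqrt_eq_rpow, ← div_eq_mul_inv, le_div_iff₀ (by positivity)]
  rcases le_total ρ 1 with h | h
  · have h2 : √(1 + ρ) ≤ 2 := sqrt_le_iff.2 ⟨by norm_num, by linarith⟩
    calc |besselJZero ρ| * √(1 + ρ) ≤ 1 * 2 := by
          gcongr; exact abs_besselJZero_le_one h0
      _ ≤ 6 := by norm_num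
  · have hs : 0 < √ρ := sqrt_pos.2 (by linarith)
    have h2 : √(1 + ρ) ≤ 2 * √ρ := by
      rw [sqrt_le_iff]
      refine ⟨by positivity, ?_⟩
      rw [mul_pow, sq_sqrt (by linarith)]
      linarith
    calc |besselJZero ρ| * √(1 + ρ) ≤ 3 / √ρ * (2 * √ρ) := by
          gcongr; exact abs_besselJZero_le_div_sqrt (by linarith)
      _ = 6 := by field_simp; norm_num

lemma continuous_besselJZero_norm : Continuous fun t : ℂ => besselJZero ‖t‖ :=
  continuous_besselJZero.comp continuous_norm

/-- Five factors decay like `‖t‖^(-5/2)`, and 5/2 exceeds the dimension 2; with four the bound would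
just fail to be integrable. -/
lemma integrable_besselJZero_norm_pow {n : ℕ} (hn : 5 ≤ n) :
    Integrable (fun t : ℂ => besselJZero ‖t‖ ^ n) := by
  have hint : Integrable (fun t : ℂ => (6 : ℝ) ^ 5 * (1 + ‖t‖) ^ (-(5 / 2) : ℝ)) := by
    refine (integrable_one_add_norm ?_).const_mul _
    rw [Complex.finrank_real_complex]
    norm_num
  refine hint.mono' (continuous_besselJZero_norm.pow n).aestronglyMeasurable
    (Eventually.of_forall fun t => ?_)
  rw [norm_pow, norm_eq_abs]
  calc |besselJZero ‖t‖| ^ n ≤ |besselJZero ‖t‖| ^ 5 :=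
        pow_le_pow_of_le_one (abs_nonneg _) (abs_besselJZero_le_one (norm_nonneg t)) hn
    _ ≤ (6 * (1 + ‖t‖) ^ (-(1 / 2) : ℝ)) ^ 5 := by
        gcongr; exact abs_besselJZero_le_rpow (norm_nonneg t)
    _ = 6 ^ 5 * (1 + ‖t‖) ^ (-(5 / 2) : ℝ) := by
        rw [mul_pow, ← rpow_natCast, ← rpow_natCast, ← rpow_mul (by positivity)]
        norm_num

lemma integrable_exp_neg_sq_norm_pow {n : ℕ} (hn : 0 < n) :
    Integrable (fun t : ℂ => exp (-(‖t‖ ^ 2 / 4)) ^ n) := by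
  refine (integrable_exp_neg_mul_sq_norm (V := ℂ) (b := n / 4) (by positivity)).congr
    (Eventually.of_forall fun t => ?_)
  simp only
  rw [← exp_nat_mul]
  congr 1
  ring

lemma exists_integral_abs_besselJZero_pow_sub_exp_le :
    ∃ C : ℝ, ∃ N : ℕ, ∀ n : ℕ, N ≤ n →
      ∫ t : ℂ, |besselJZero ‖t‖ ^ n - exp (-(‖t‖ ^ 2 / 4)) ^ n| ≤ C / (n : ℝ) ^ 2 := by
  obtain ⟨q, hq0, hq1, hq⟩ := exists_abs_besselJZero_le
  set r : ℝ := max q (exp (-(1 / 4))) with hr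
  have hr0 : 0 < r := lt_max_of_lt_left hq0
  have hr1 : r < 1 := max_lt hq1 (Real.exp_lt_one_iff.2 (by norm_num))
  set H : ℂ → ℝ := fun t => |besselJZero ‖t‖ ^ 5| + exp (-(‖t‖ ^ 2 / 4)) ^ 5 with hH
  have hHint : Integrable H :=
    (integrable_besselJZero_norm_pow le_rfl).abs.add (integrable_exp_neg_sq_norm_pow (by norm_num))
  have hH0 : ∀ t, 0 ≤ H t := fun t => by simp only [hH]; positivity
  have hev : ∀ᶠ n : ℕ in atTop, (n : ℝ) ^ 2 * r ^ n ≤ 1 :=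
    (tendsto_pow_const_mul_const_pow_of_abs_lt_one 2
      (by rwa [abs_of_pos hr0])).eventually_le_const one_pos
  obtain ⟨N, hN⟩ := eventually_atTop.1 hev
  refine ⟨2048 * (32 * π) + (r ^ 5)⁻¹ * ∫ t, H t, max N 5, fun n hn => ?_⟩
  have hn5 : 5 ≤ n := (le_max_right _ _).trans hn
  have hnN := hN n ((le_max_left _ _).trans hn)
  have hn0 : (0 : ℝ) < n := by positivity
  have hgint : Integrable (fun t : ℂ => 2048 / n * exp (-(n / 32) * ‖t‖ ^ 2)) :=
    (integrable_exp_neg_mul_sq_norm (V := ℂ) (b := (n : ℝ) / 32) (by positivity)).const_mul _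
  have hgval : ∫ t : ℂ, 2048 / n * exp (-(n / 32) * ‖t‖ ^ 2) = 2048 * (32 * π) / (n : ℝ) ^ 2 := by
    rw [MeasureTheory.integral_const_mul,
      GaussianFourier.integral_rexp_neg_mul_sq_norm (by positivity), Complex.finrank_real_complex]
    norm_num
    field_simp
  -- Outside the unit disc five factors are kept in `H` for integrability; the other `n - 5` give
  -- geometric decay.
  have hrn : r ^ (n - 5) ≤ (r ^ 5)⁻¹ / (n : ℝ) ^ 2 := by
    rw [pow_sub₀ _ hr0.ne' hn5, mul_comm, div_eq_mul_inv]
    gcongr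
    rw [← one_div, le_div_iff₀ (by positivity)]
    linarith
  have hpt : ∀ t : ℂ, |besselJZero ‖t‖ ^ n - exp (-(‖t‖ ^ 2 / 4)) ^ n| ≤
      2048 / n * exp (-(n / 32) * ‖t‖ ^ 2) + r ^ (n - 5) * H t := by
    intro t
    rcases le_total ‖t‖ 1 with h | h
    · refine (abs_besselJZero_pow_sub_exp_le (norm_nonneg t) h (by omega)).trans ?_
      exact le_add_of_nonneg_right (mul_nonneg (by positivity) (hH0 t))
    · refine le_add_of_nonneg_of_le (by positivity) ((abs_sub _ _).trans ?_)
      have hsplit : ∀ x : ℝ, |x| ≤ r → |x ^ n| ≤ r ^ (n - 5) * |x ^ 5| := fun x hx => by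
        rw [abs_pow, abs_pow, ← Nat.sub_add_cancel hn5, pow_add, Nat.add_sub_cancel]
        gcongr
      have h1 := hsplit _ ((hq _ h).trans (le_max_left _ _))
      have h2 := hsplit (exp (-(‖t‖ ^ 2 / 4))) (by
        rw [abs_exp]
        refine le_max_of_le_right (exp_le_exp.2 ?_)
        nlinarith)
      rw [abs_of_pos (a := exp (-(‖t‖ ^ 2 / 4)) ^ 5) (by positivity)] at h2
      simp only [hH, mul_add]
      exact add_le_add h1 h2
  calc ∫ t : ℂ, |besselJZero ‖t‖ ^ n - exp (-(‖t‖ ^ 2 / 4)) ^ n|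
      ≤ ∫ t : ℂ, (2048 / n * exp (-(n / 32) * ‖t‖ ^ 2) + r ^ (n - 5) * H t) :=
        integral_mono ((integrable_besselJZero_norm_pow hn5).sub
          (integrable_exp_neg_sq_norm_pow (by omega))).abs
          (hgint.add (hHint.const_mul _)) hpt
    _ = 2048 * (32 * π) / (n : ℝ) ^ 2 + r ^ (n - 5) * ∫ t, H t := by
        rw [integral_add hgint (hHint.const_mul _), hgval, MeasureTheory.integral_const_mul]
    _ ≤ 2048 * (32 * π) / (n : ℝ) ^ 2 + (r ^ 5)⁻¹ / (n : ℝ) ^ 2 * ∫ t, H t := by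
        gcongr
    _ = _ := by ring

end CharFunEstimates

/-! ### Characteristic function of the walk -/

section WalkLaw

open Real Filter
open scoped FourierTransform RealInnerProductSpace

/-- Translation by π changes the sign of the integrand, while periodicity preserves the integral. -/
lemma integral_sin_mul_cos_eq_zero (ρ : ℝ) : ∫ s in -π..π, sin (ρ * cos s) = 0 := by
  have hper : Function.Periodic (fun s => sin (ρ * cos s)) (2 * π) := fun s => by simp
  have h1 := hper.intervalIntegral_add_eq (-π) 0
  have h2 := intervalIntegral.integral_comp_add_right (a := -π) (b := π)
    (fun s => sin (ρ * cos s)) π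
  simp only [cos_add_pi, mul_neg, sin_neg, intervalIntegral.integral_neg, neg_add_cancel] at h2
  rw [show -π + 2 * π = π by ring, zero_add] at h1
  rw [show π + π = 2 * π by ring] at h2
  linarith

lemma integral_cexp_mul_cos (ρ : ℝ) :
    ∫ s in -π..π, Complex.exp ((ρ * cos s : ℝ) * Complex.I) = (2 * π * besselJZero ρ : ℝ) := by
  have h : ∀ s : ℝ, Complex.exp ((ρ * cos s : ℝ) * Complex.I) =
      ((cos (ρ * cos s) : ℝ) : ℂ) + ((sin (ρ * cos s) : ℝ) : ℂ) * Complex.I := fun s => by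
    rw [Complex.exp_mul_I, Complex.ofReal_cos, Complex.ofReal_sin]
  simp only [h]
  rw [intervalIntegral.integral_add (Continuous.intervalIntegrable (by fun_prop) _ _)
    (Continuous.intervalIntegrable (by fun_prop) _ _), intervalIntegral.integral_mul_const,
    intervalIntegral.integral_ofReal, intervalIntegral.integral_ofReal,
    integral_sin_mul_cos_eq_zero, two_pi_mul_besselJZero]
  simp

lemma inner_cexp_mul_I (s : ℝ) (t : ℂ) :
    ⟪Complex.exp (s * Complex.I), t⟫ = ‖t‖ * cos (s - t.arg) := by
  rw [Complex.inner]
  conv_lhs => rw [← Complex.norm_mul_exp_arg_mul_I t]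
  rw [← Complex.exp_conj, mul_assoc, ← Complex.exp_add, map_mul, Complex.conj_ofReal,
    Complex.conj_I, show (t.arg : ℂ) * Complex.I + s * -Complex.I =
      ((t.arg - s : ℝ) : ℂ) * Complex.I by push_cast; ring, Complex.re_ofReal_mul,
    Complex.exp_ofReal_mul_I_re, ← cos_neg, neg_sub]

/-- The characteristic function of the uniform distribution on the unit circle. -/
lemma charFun_uniformCircle (t : ℂ) : charFun uniformCircle t = (besselJZero ‖t‖ : ℝ) := by
  have hcont : Continuous fun s : ℝ => Complex.exp ((s : ℂ) * Complex.I) := by fun_prop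
  rw [charFun_apply, uniformCircle, integral_smul_measure,
    integral_map hcont.aemeasurable (Continuous.aestronglyMeasurable (by fun_prop)),
    ← intervalIntegral.integral_of_le (by linarith [pi_pos])]
  simp only [inner_cexp_mul_I]
  have hper : Function.Periodic
      (fun s => Complex.exp ((‖t‖ * cos s : ℝ) * Complex.I)) (2 * π) := fun s => by simp
  rw [intervalIntegral.integral_comp_sub_right
    (fun s => Complex.exp ((‖t‖ * cos s : ℝ) * Complex.I)) t.arg,
    show π - t.arg = -π - t.arg + 2 * π by ring, hper.intervalIntegral_add_eq _ (-π),
    show -π + 2 * π = π by ring, integral_cexp_mul_cos, ENNReal.toReal_inv,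
    ENNReal.toReal_ofReal (by positivity), Complex.real_smul, ← Complex.ofReal_mul, ← mul_assoc,
    inv_mul_cancel₀ (by positivity), one_mul]

variable {Ω : Type*} [MeasurableSpace Ω] {P : Measure Ω} {n : ℕ} {X : Fin (n + 1) → Ω → ℂ}

omit [MeasurableSpace Ω] in
lemma sum_walkStep (h0 : ∀ ω, X 0 ω = 0) (ω : Ω) :
    ∑ k, walkStep X k ω = X (Fin.last n) ω := by
  simp only [walkStep]
  rw [Finset.sum_sub_distrib]
  have h1 := Fin.sum_univ_succ (fun k => X k ω)
  have h2 := Fin.sum_univ_castSucc (fun k => X k ω)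
  rw [h0, zero_add] at h1
  rw [← h1, h2, add_sub_cancel_left]

lemma IsRandomWalk.measurable_walkStep (h : IsRandomWalk P X) (k : Fin n) :
    Measurable (walkStep X k) :=
  (h.measurable _).sub (h.measurable _)

/-- A step of unit length coincides with its direction. -/
lemma map_walkStep_eq_uniformCircle (hiso : IsIsotropic P X) (hequi : IsEquilateral P X)
    (k : Fin n) : P.map (walkStep X k) = uniformCircle := by
  rw [← hiso.direction k]
  refine Measure.map_congr ?_
  filter_upwards [hequi k] with ω hω
  simp [hω]

lemma charFun_map_walk_last (hwalk : IsRandomWalk P X) (hiso : IsIsotropic P X)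
    (hequi : IsEquilateral P X) :
    charFun (P.map (X (Fin.last n))) = fun t => ((besselJZero ‖t‖ ^ n : ℝ) : ℂ) := by
  have h := hwalk.indep.charFun_map_fun_sum_eq_prod
    (fun k => (hwalk.measurable_walkStep k).aemeasurable)
  simp only [sum_walkStep hwalk.start, map_walkStep_eq_uniformCircle hiso hequi] at h
  rw [show X (Fin.last n) = fun ω => X (Fin.last n) ω from rfl, h]
  funext t
  simp [charFun_uniformCircle]

end WalkLaw

/-! ### From transforms to densities -/

section LocalLimit

open Real Filter
open scoped FourierTransform RealInnerProductSpace

lemma norm_fourier_sub_le {V : Type*} [NormedAddCommGroup V] [InnerProductSpace ℝ V]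
    [FiniteDimensional ℝ V] [MeasurableSpace V] [BorelSpace V] {f g : V → ℂ} (hf : Integrable f)
    (hg : Integrable g) (z : V) : ‖𝓕 f z - 𝓕 g z‖ ≤ ∫ v, ‖f v - g v‖ := by
  have hconv : ∀ {f : V → ℂ}, Integrable f → Integrable (fun v => 𝐞 (-⟪v, z⟫) • f v) :=
    fun hf => (VectorFourier.fourierIntegral_convergent_iff Real.continuous_fourierChar
      (L := innerₗ V) continuous_inner z).2 hf
  rw [Real.fourier_eq, Real.fourier_eq, ← integral_sub (hconv hf) (hconv hg)]
  refine (norm_integral_le_integral_norm _).trans (le_of_eq ?_)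
  simp only [← smul_sub, Circle.norm_smul]

lemma ofReal_exp_neg_sq_norm_pow_two_pi_smul (n : ℕ) (w : ℂ) :
    ((exp (-(‖(2 * π) • w‖ ^ 2 / 4)) ^ n : ℝ) : ℂ) =
      Complex.exp (-((n * π ^ 2 : ℝ) : ℂ) * ‖w‖ ^ 2) := by
  rw [← exp_nat_mul, norm_smul, norm_of_nonneg (by positivity)]
  push_cast
  congr 1
  ring

lemma fourier_exp_neg_sq_norm_pow {n : ℕ} (hn : 0 < n) (z : ℂ) :
    𝓕 (fun w : ℂ => ((exp (-(‖(2 * π) • w‖ ^ 2 / 4)) ^ n : ℝ) : ℂ)) z =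
      ((1 / (π * n) * exp (-(‖z‖ ^ 2 / n)) : ℝ) : ℂ) := by
  have hn0 : (n : ℂ) ≠ 0 := by exact_mod_cast hn.ne'
  have hπ : (π : ℂ) ≠ 0 := by exact_mod_cast pi_ne_zero
  simp only [ofReal_exp_neg_sq_norm_pow_two_pi_smul]
  rw [fourier_gaussian_innerProductSpace (by rw [Complex.ofReal_re]; positivity),
    Complex.finrank_real_complex]
  push_cast
  rw [div_self two_ne_zero, Complex.cpow_one]
  congr 1
  · field_simp
  · congr 1
    field_simp

lemma abs_levyDensity_sub_gaussian_le {μ : Measure ℂ} [IsProbabilityMeasure μ] {n : ℕ}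
    (hn : 5 ≤ n) (hμ : charFun μ = fun t => ((besselJZero ‖t‖ ^ n : ℝ) : ℂ)) (z : ℂ) :
    |(levyDensity μ z).re - 1 / (π * n) * exp (-(‖z‖ ^ 2 / n))| ≤
      ((2 * π) ^ 2)⁻¹ * ∫ t : ℂ, |besselJZero ‖t‖ ^ n - exp (-(‖t‖ ^ 2 / 4)) ^ n| := by
  have hf : Integrable (fun t : ℂ => ((besselJZero ‖t‖ ^ n : ℝ) : ℂ)) :=
    (integrable_besselJZero_norm_pow hn).ofReal
  have hg : Integrable (fun t : ℂ => ((exp (-(‖t‖ ^ 2 / 4)) ^ n : ℝ) : ℂ)) :=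
    (integrable_exp_neg_sq_norm_pow (by omega)).ofReal
  have h2π : 2 * π ≠ 0 := by positivity
  have key := norm_fourier_sub_le (hf.comp_smul h2π) (hg.comp_smul h2π) z
  rw [fourier_exp_neg_sq_norm_pow (by omega)] at key
  simp only [levyDensity, hμ]
  refine le_trans ?_ (key.trans (le_of_eq ?_))
  · refine le_trans (le_of_eq ?_) (Complex.abs_re_le_norm _)
    rw [Complex.sub_re, Complex.ofReal_re]
  · simp only [← Complex.ofReal_sub, Complex.norm_real, norm_eq_abs]
    -- The substitution `t = 2πw` in the plane produces the factor `(2π)⁻²`.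
    rw [Measure.integral_comp_smul volume
      (fun t : ℂ => |besselJZero ‖t‖ ^ n - exp (-(‖t‖ ^ 2 / 4)) ^ n|) (2 * π),
      Complex.finrank_real_complex, abs_of_pos (by positivity), smul_eq_mul]

end LocalLimit

end

theorem proposition2p1
    {Ω : ℕ → Type*} [∀ n, MeasurableSpace (Ω n)]
    (P : ∀ n, Measure (Ω n)) [∀ n, IsProbabilityMeasure (P n)]
    (X : ∀ n, Fin (n + 1) → Ω n → ℂ)
    (hwalk : ∀ n, IsRandomWalk (P n) (X n))
    (hiso : ∀ n, IsIsotropic (P n) (X n))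
    (hequi : ∀ n, IsEquilateral (P n) (X n)) :
    IsQuasiGaussian (fun n => (P n).map (X n (Fin.last n))) := by
  obtain ⟨C, N, hC⟩ := exists_integral_abs_besselJZero_pow_sub_exp_le
  refine ⟨((2 * Real.pi) ^ 2)⁻¹ * C, max N 5, fun n hn => ?_⟩
  have hn5 : 5 ≤ n := (le_max_right _ _).trans hn
  have hchar := charFun_map_walk_last (hwalk n) (hiso n) (hequi n)
  have : IsProbabilityMeasure ((P n).map (X n (Fin.last n))) :=
    Measure.isProbabilityMeasure_map ((hwalk n).measurable _).aemeasurable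
  have hint : Integrable (charFun ((P n).map (X n (Fin.last n)))) := by
    rw [hchar]
    exact (integrable_besselJZero_norm_pow hn5).ofReal
  refine ⟨fun z => (levyDensity ((P n).map (X n (Fin.last n))) z).re,
    ⟨(Complex.continuous_re.comp (continuous_levyDensity hint)).measurable,
      levyDensity_re_nonneg hint, eq_withDensity_levyDensity hint⟩, fun r hr θ => ?_⟩
  have h := abs_levyDensity_sub_gaussian_le hn5 hchar
    ((r : ℂ) * Complex.exp ((θ : ℂ) * Complex.I))
  rw [norm_mul, Complex.norm_exp_ofReal_mul_I, mul_one, Complex.norm_real,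
    Real.norm_of_nonneg hr] at h
  refine h.trans ?_
  rw [mul_div_assoc]
  exact mul_le_mul_of_nonneg_left (hC n ((le_max_left _ _).trans hn)) (by positivity)
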